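/- Let $P \subset \mathbb{R}^d$ be a $d$-dimensional polytope (the convex hull of finitely many points, not contained in any hyperplane). Define its Fourier–Laplace transform by $\hat 1_P(z) = \int_P e^{-2\pi i \langle x, z\rangle}\,dx$ for $z \in \mathbb{C}^d$, where $\langle x, z\rangle = x_1 z_1 + \cdots + x_d z_d$, and its null set by $N(P) = \{ z \in \mathbb{C}^d : \hat 1_P(z) = 0\}$. Let $H \subset \mathbb{R}^d$ be a $2$-dimensional real linear subspace that is not orthogonal to any edge of $P$ (that is, no edge of $P$ has its direction in $H^\perp$), and let $\{e, f\}$ be an orthonormal basis of $H$. Then for every $\alpha \in \mathbb{C}\setminus\{0\}$ the null set $N(P)$ does not contain the "circle" $$C_\alpha = \{ \alpha (\cos t)\, e + \alpha (\sin t)\, f \in \mathbb{C}^d : t \in [-\pi, \pi] \}.$$ -/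

import Mathlib

/-- A polytope in `ℝ^d`: the convex hull of finitely many points. -/
def IsPolytope {d : ℕ} (P : Set (EuclideanSpace ℝ (Fin d))) : Prop :=
  ∃ S : Set (EuclideanSpace ℝ (Fin d)), S.Finite ∧ P = convexHull ℝ S

/-- An edge of `P`: a one-dimensional face. A nonempty face is the set of all points of `P` at
which some linear functional attains its maximum over `P`; the dimension of a set is the dimension
of its affine hull. (A set of dimension one is nonempty.) -/
def IsPolytopeEdge {d : ℕ} (P F : Set (EuclideanSpace ℝ (Fin d))) : Prop :=
  IsExposed ℝ P F ∧ Module.finrank ℝ (vectorSpan ℝ F) = 1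

/-- The Fourier–Laplace transform `z ↦ ∫_P exp (-2πi ⟨x, z⟩) dx` of the indicator function of `P`,
where `⟨x, z⟩ = x₁ z₁ + ⋯ + x_d z_d` is bilinear (not Hermitian). -/
noncomputable def fourierLaplace {d : ℕ} (P : Set (EuclideanSpace ℝ (Fin d)))
    (z : Fin d → ℂ) : ℂ :=
  ∫ x in P, Complex.exp (-2 * (Real.pi : ℂ) * Complex.I * ∑ j, (x j : ℂ) * z j)

/-- The null set `N(P) ⊆ ℂ^d` of the Fourier–Laplace transform of `P`. -/
def nullSet {d : ℕ} (P : Set (EuclideanSpace ℝ (Fin d))) : Set (Fin d → ℂ) :=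
  {z | fourierLaplace P z = 0}

/-- The "circle" `{α (cos t) e + α (sin t) f : t ∈ [-π, π]} ⊆ ℂ^d`. -/
def complexCircle {d : ℕ} (α : ℂ) (e f : EuclideanSpace ℝ (Fin d)) : Set (Fin d → ℂ) :=
  {z | ∃ t ∈ Set.Icc (-Real.pi) Real.pi,
    z = fun j => α * (Real.cos t : ℂ) * (e j : ℂ) + α * (Real.sin t : ℂ) * (f j : ℂ)}

/-! ### Generic directions, vertices and edges of a polytope. -/

open scoped InnerProductSpace

/-! Suppose the circle lies in the null set. The transform along it is entire in `t`, so it vanishes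
for all complex `t`. With `W = exp (i t)`, `z` the complex coordinate on `H` and `c = π i α`, this
reads `∫_P exp (-c (W z̄ + W⁻¹ z)) = 0` for every `W ≠ 0` (`integral_exp_planeCoord_eq_zero`).

Since no edge is orthogonal to `H`, some direction of `H` is minimised over `P` at a single vertex
(`exists_unique_minimizer_of_not_isOrtho_edge`). Move that vertex to `0` and rotate `z` to a
coordinate `ζ` with positive real part on the rest of `P`. A suitable `W` of size `r` turns the
exponent into `-r (ζ̄ + s ζ)` with `s = κ / r²`.

Replacing `P` by its tangent cone costs an exponentially small error, and homogeneity of the cone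
gives `G(κ / r²) = O(r^d exp (-δ r))`, where `G` is `coneLaplace`. Now `G` is analytic near `[0,
1]`, so it vanishes to infinite order at `0` and hence also at `1`. But `G(1)` integrates the
positive function `exp (-2 Re ζ)`: a contradiction (`exists_integral_exp_ne_zero`). -/

theorem exists_mem_forall_inner_eq_zero {E : Type*} [NormedAddCommGroup E]
    [InnerProductSpace ℝ E] (H : Submodule ℝ E) {U : Set E} (hU : U.Finite) :
    ∃ y ∈ H, ∀ u ∈ U, ⟪u, y⟫_ℝ = 0 → ∀ h ∈ H, ⟪u, h⟫_ℝ = 0 := by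
  by_contra! hcon
  let ι := {u : E // u ∈ U ∧ ∃ h ∈ H, ⟪u, h⟫_ℝ ≠ 0}
  have : Finite ι := (hU.subset (fun u (hu : u ∈ U ∧ ∃ h ∈ H, ⟪u, h⟫_ℝ ≠ 0) => hu.1)).to_subtype
  let p : ι → Subspace ℝ H := fun u => ((innerSL ℝ u.1).toLinearMap.comp H.subtype).ker
  -- A real vector space is not a finite union of proper subspaces.
  obtain ⟨u, hu⟩ := Subspace.exists_eq_top_of_iUnion_eq_univ (p := p) (by
    refine Set.eq_univ_of_forall fun y => Set.mem_iUnion.2 ?_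
    obtain ⟨u, huU, huy, hu⟩ := hcon y y.2
    exact ⟨⟨u, huU, hu⟩, by simpa [p] using huy⟩)
  obtain ⟨h, hh, hne⟩ := u.2.2
  have : (⟨h, hh⟩ : H) ∈ p u := hu ▸ Submodule.mem_top
  exact hne (by simpa [p] using this)

theorem exists_forall_mul_add_pos {E : Type*} {S : Set E} (hS : S.Finite) (y l : E → ℝ) :
    ∃ M : ℝ, ∀ s ∈ S, 0 < y s → 0 < M * y s + l s := by
  have h : ∀ᶠ M : ℝ in Filter.atTop, ∀ s ∈ S, 0 < y s → 0 < M * y s + l s := by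
    refine (Filter.eventually_all_finite hS).2 fun s _ => ?_
    by_cases hs : 0 < y s
    · filter_upwards [Filter.eventually_gt_atTop (-l s / y s)] with M hM _
      rw [div_lt_iff₀ hs] at hM
      linarith
    · exact Filter.Eventually.of_forall fun M h => absurd h hs
  exact h.exists

/-- This finds an edge inside the face where `y` is minimal. A generic `l` picks a vertex `v` of
that face; the least slope of a second generic `g` against `l`, seen from `v`, picks the edge
direction. Adding a large multiple of `y` to `g - ρ • l` makes the functional positive off the face.
-/
theorem exists_supporting_ray {E : Type*} [NormedAddCommGroup E] [InnerProductSpace ℝ E]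
    {S : Set E} (hS : S.Finite) {y a b : E} (ha : a ∈ S) (hb : b ∈ S) (hab : a ≠ b)
    (hmin : ∀ s ∈ S, ⟪a, y⟫_ℝ ≤ ⟪s, y⟫_ℝ) (hy : ⟪a, y⟫_ℝ = ⟪b, y⟫_ℝ) :
    ∃ v ∈ S, ∃ t ∈ S, t ≠ v ∧ ⟪t - v, y⟫_ℝ = 0 ∧ ∃ w : E, ⟪t - v, w⟫_ℝ = 0 ∧
      ∀ s ∈ S, 0 ≤ ⟪s - v, w⟫_ℝ ∧ (⟪s - v, w⟫_ℝ = 0 → s - v ∈ Submodule.span ℝ {t - v}) := by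
  obtain ⟨l, -, hl⟩ := exists_mem_forall_inner_eq_zero (⊤ : Submodule ℝ E) (hS.sub hS)
  let T : Set E := {s | s ∈ S ∧ ⟪s, y⟫_ℝ = ⟪a, y⟫_ℝ}
  have hT : T.Finite := hS.subset fun s hs => hs.1
  obtain ⟨v, hvT, hv⟩ := hT.exists_minimalFor (fun s => ⟪s, l⟫_ℝ) T ⟨a, ha, rfl⟩
  replace hv : ∀ t ∈ T, ⟪v, l⟫_ℝ ≤ ⟪t, l⟫_ℝ := fun t ht => by
    rcases le_total ⟪v, l⟫_ℝ ⟪t, l⟫_ℝ with h | h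
    · exact h
    · exact hv ht h
  have hpos : ∀ t ∈ T, t ≠ v → 0 < ⟪t - v, l⟫_ℝ := fun t ht htv => by
    refine lt_of_le_of_ne (by rw [inner_sub_left]; linarith [hv t ht]) fun h => htv ?_
    have := hl (t - v) (Set.sub_mem_sub ht.1 hvT.1) h.symm (t - v) Submodule.mem_top
    exact sub_eq_zero.1 (inner_self_eq_zero.1 this)
  let T' : Set E := T \ {v}
  have hT' : T'.Finite := hT.subset Set.sdiff_subset
  have hT'ne : T'.Nonempty := by
    by_cases h : a = v
    · exact ⟨b, ⟨hb, hy.symm⟩, fun h' => hab (h.trans h'.symm)⟩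
    · exact ⟨a, ⟨ha, rfl⟩, h⟩
  -- Equal slopes at `t` and `t'` say that `g` is orthogonal to this combination, so genericity
  -- forces `t - v` and `t' - v` to be parallel.
  obtain ⟨g, -, hg⟩ := exists_mem_forall_inner_eq_zero (⊤ : Submodule ℝ E)
    (Set.Finite.image2 (fun t t' => ⟪t' - v, l⟫_ℝ • (t - v) - ⟪t - v, l⟫_ℝ • (t' - v)) hT' hT')
  obtain ⟨t, htT', ht⟩ := hT'.exists_minimalFor
    (fun s => ⟪s - v, g⟫_ℝ / ⟪s - v, l⟫_ℝ) T' hT'ne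
  replace ht : ∀ s ∈ T', ⟪t - v, g⟫_ℝ / ⟪t - v, l⟫_ℝ ≤ ⟪s - v, g⟫_ℝ / ⟪s - v, l⟫_ℝ :=
    fun s hs => by
      rcases le_total (⟪t - v, g⟫_ℝ / ⟪t - v, l⟫_ℝ) (⟪s - v, g⟫_ℝ / ⟪s - v, l⟫_ℝ) with h | h
      · exact h
      · exact ht hs h
  have htpos := hpos t htT'.1 htT'.2
  set ρ := ⟪t - v, g⟫_ℝ / ⟪t - v, l⟫_ℝ with hρ
  have htρ : ⟪t - v, g⟫_ℝ = ρ * ⟪t - v, l⟫_ℝ := by rw [hρ]; field_simp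
  obtain ⟨M, hM⟩ := exists_forall_mul_add_pos hS (fun s => ⟪s - v, y⟫_ℝ)
    (fun s => ⟪s - v, g - ρ • l⟫_ℝ)
  have hTy : ∀ s ∈ T, ⟪s - v, y⟫_ℝ = 0 := fun s hs => by
    rw [inner_sub_left, hs.2, hvT.2, sub_self]
  have hinner : ∀ s, ⟪s - v, M • y + (g - ρ • l)⟫_ℝ
      = M * ⟪s - v, y⟫_ℝ + (⟪s - v, g⟫_ℝ - ρ * ⟪s - v, l⟫_ℝ) := fun s => by
    simp only [inner_add_right, inner_sub_right, inner_smul_right]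
  refine ⟨v, hvT.1, t, htT'.1.1, htT'.2, hTy t htT'.1, M • y + (g - ρ • l), ?_, fun s hs => ?_⟩
  · rw [hinner, hTy t htT'.1, htρ]; ring
  by_cases hsy : ⟪s - v, y⟫_ℝ = 0
  · have hsT : s ∈ T := ⟨hs, by rw [← hvT.2]; rw [inner_sub_left] at hsy; linarith⟩
    by_cases hsv : s = v
    · subst hsv; simp
    have hspos := hpos s hsT hsv
    have h1 := ht s ⟨hsT, hsv⟩
    rw [hinner, hsy]
    rw [le_div_iff₀ hspos] at h1
    refine ⟨by linarith, fun h0 => ?_⟩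
    have h2 : ∀ h ∈ (⊤ : Submodule ℝ E),
        ⟪⟪t - v, l⟫_ℝ • (s - v) - ⟪s - v, l⟫_ℝ • (t - v), h⟫_ℝ = 0 := hg _ (Set.mem_image2_of_mem (⟨hsT, hsv⟩ : s ∈ T') htT') (by
      rw [inner_sub_left, real_inner_smul_left, real_inner_smul_left, htρ]
      linear_combination ⟪t - v, l⟫_ℝ * h0)
    have h3 := sub_eq_zero.1 (inner_self_eq_zero.1 (h2 _ Submodule.mem_top))
    refine Submodule.mem_span_singleton.2 ⟨(⟪t - v, l⟫_ℝ)⁻¹ * ⟪s - v, l⟫_ℝ, ?_⟩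
    rw [mul_smul, ← h3, smul_smul, inv_mul_cancel₀ htpos.ne', one_smul]
  · have h0 : 0 < ⟪s - v, y⟫_ℝ := by
      refine lt_of_le_of_ne ?_ (Ne.symm hsy)
      rw [inner_sub_left, hvT.2]
      linarith [hmin s hs]
    have := hM s hs h0
    rw [inner_add_right, inner_smul_right]
    exact ⟨this.le, fun h => absurd h this.ne'⟩

theorem inner_sub_nonneg_of_mem_convexHull {E : Type*} [NormedAddCommGroup E]
    [InnerProductSpace ℝ E] {S : Set E} {v w : E} {W : Submodule ℝ E}
    (h : ∀ s ∈ S, 0 ≤ ⟪s - v, w⟫_ℝ ∧ (⟪s - v, w⟫_ℝ = 0 → s - v ∈ W)) :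
    ∀ x ∈ convexHull ℝ S, 0 ≤ ⟪x - v, w⟫_ℝ ∧ (⟪x - v, w⟫_ℝ = 0 → x - v ∈ W) := by
  refine convexHull_min (t := {x | 0 ≤ ⟪x - v, w⟫_ℝ ∧ (⟪x - v, w⟫_ℝ = 0 → x - v ∈ W)}) h ?_
  intro x hx z hz p q hp hq hpq
  have e : p • x + q • z - v = p • (x - v) + q • (z - v) := by
    have : v = p • v + q • v := by rw [← add_smul, hpq, one_smul]
    nth_rewrite 1 [this]
    simp only [smul_sub]; abel
  simp only [Set.mem_ofPred_eq, e, inner_add_left, real_inner_smul_left]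
  have h1 := mul_nonneg hp hx.1
  have h2 := mul_nonneg hq hz.1
  refine ⟨add_nonneg h1 h2, fun h0 => W.add_mem ?_ ?_⟩
  · rcases mul_eq_zero.1 (by linarith : p * ⟪x - v, w⟫_ℝ = 0) with h | h
    · simp [h]
    · exact W.smul_mem _ (hx.2 h)
  · rcases mul_eq_zero.1 (by linarith : q * ⟪z - v, w⟫_ℝ = 0) with h | h
    · simp [h]
    · exact W.smul_mem _ (hz.2 h)

theorem isPolytopeEdge_of_supporting_ray {d : ℕ} {S : Set (EuclideanSpace ℝ (Fin d))}
    {v t w : EuclideanSpace ℝ (Fin d)} (hv : v ∈ S) (ht : t ∈ S) (htv : t ≠ v)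
    (htw : ⟪t - v, w⟫_ℝ = 0)
    (h : ∀ s ∈ S, 0 ≤ ⟪s - v, w⟫_ℝ ∧
      (⟪s - v, w⟫_ℝ = 0 → s - v ∈ Submodule.span ℝ {t - v})) :
    ∃ F, IsPolytopeEdge (convexHull ℝ S) F ∧ vectorSpan ℝ F = Submodule.span ℝ {t - v} := by
  have hhull := inner_sub_nonneg_of_mem_convexHull h
  let F : Set (EuclideanSpace ℝ (Fin d)) := {x | x ∈ convexHull ℝ S ∧ ⟪x - v, w⟫_ℝ = 0}
  have hvF : v ∈ F := ⟨subset_convexHull ℝ S hv, by simp⟩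
  have htF : t ∈ F := ⟨subset_convexHull ℝ S ht, htw⟩
  have hspan : vectorSpan ℝ F = Submodule.span ℝ {t - v} := by
    apply le_antisymm
    · rw [vectorSpan_eq_span_vsub_set_right ℝ hvF, Submodule.span_le]
      rintro _ ⟨x, hx, rfl⟩
      exact (hhull x hx.1).2 hx.2
    · rw [Submodule.span_singleton_le_iff_mem]
      exact vsub_mem_vectorSpan ℝ htF hvF
  refine ⟨F, ⟨fun _ => ⟨-(innerSL ℝ w), ?_⟩, ?_⟩, hspan⟩
  · ext x
    simp only [F, Set.mem_ofPred_eq, neg_apply, innerSL_apply_apply,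
      neg_le_neg_iff]
    refine and_congr_right fun hx => ⟨fun hx0 z hz => ?_, fun hx' => ?_⟩
    · have := (hhull z hz).1
      rw [inner_sub_left] at this hx0
      rw [real_inner_comm x, real_inner_comm z]
      linarith
    · have h1 := hx' v hvF.1
      have h2 := (hhull x hx).1
      rw [real_inner_comm x, real_inner_comm v] at h1
      rw [inner_sub_left] at h2 ⊢
      linarith
  · rw [hspan, finrank_span_singleton (sub_ne_zero.2 htv)]

theorem exists_unique_minimizer_of_not_isOrtho_edge {d : ℕ}
    {S : Set (EuclideanSpace ℝ (Fin d))} (hS : S.Finite) (hne : S.Nonempty)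
    {H : Submodule ℝ (EuclideanSpace ℝ (Fin d))} (hH : H ≠ ⊥)
    (hedge : ∀ F : Set (EuclideanSpace ℝ (Fin d)), IsPolytopeEdge (convexHull ℝ S) F →
      ¬ Submodule.IsOrtho H (vectorSpan ℝ F)) :
    ∃ v ∈ S, ∃ y ∈ H, y ≠ 0 ∧ ∀ s ∈ S, s ≠ v → 0 < ⟪s - v, y⟫_ℝ := by
  obtain ⟨h, hhH, hh0⟩ := (Submodule.ne_bot_iff H).1 hH
  -- Including the nonzero `h` among the test vectors is what ensures `y ≠ 0`.
  obtain ⟨y, hyH, hy⟩ := exists_mem_forall_inner_eq_zero H ((hS.sub hS).insert h)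
  obtain ⟨v, hv, hmin⟩ := hS.exists_minimalFor (fun s => ⟪s, y⟫_ℝ) S hne
  replace hmin : ∀ s ∈ S, ⟪v, y⟫_ℝ ≤ ⟪s, y⟫_ℝ := fun s hs => by
    rcases le_total ⟪v, y⟫_ℝ ⟪s, y⟫_ℝ with h | h
    · exact h
    · exact hmin hs h
  refine ⟨v, hv, y, hyH, fun h0 => ?_, fun s hs hsv => ?_⟩
  · exact hh0 (inner_self_eq_zero.1 (hy h (Set.mem_insert _ _) (by simp [h0]) h hhH))
  refine lt_of_le_of_ne (by rw [inner_sub_left]; linarith [hmin s hs]) fun h0 => ?_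
  obtain ⟨a, ha, t, ht, hta, hty, w, htw, hw⟩ := exists_supporting_ray hS hv hs (Ne.symm hsv)
    hmin (by rw [inner_sub_left] at h0; linarith)
  obtain ⟨F, hF, hFspan⟩ := isPolytopeEdge_of_supporting_ray ha ht hta htw hw
  refine hedge F hF ?_
  rw [hFspan, Submodule.isOrtho_iff_inner_eq]
  intro x hx z hz
  obtain ⟨c, rfl⟩ := Submodule.mem_span_singleton.1 hz
  rw [inner_smul_right, real_inner_comm,
    hy (t - a) (Set.mem_insert_of_mem _ (Set.sub_mem_sub ht ha)) hty x hx, mul_zero]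

/-! ### Analyticity and non-vanishing of the Laplace transform of a cone. -/

section LaplaceTransform

open MeasureTheory Filter Topology

theorem exp_neg_mul_le_mul_one_add_pow {c u : ℝ} (hc : 0 < c) (hu : 0 ≤ u) (n : ℕ) :
    Real.exp (-(c * u)) ≤ n.factorial * Real.exp c / c ^ n * ((1 + u) ^ n)⁻¹ := by
  have h := Real.pow_div_factorial_le_exp (c * (1 + u)) (by positivity) n
  rw [div_le_iff₀ (by positivity), mul_pow, mul_add, mul_one, Real.exp_add] at h
  rw [Real.exp_neg, ← div_eq_mul_inv, div_div, inv_eq_one_div,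
    div_le_div_iff₀ (Real.exp_pos _) (by positivity)]
  linarith

variable {E : Type*} [NormedAddCommGroup E] [NormedSpace ℝ E] [FiniteDimensional ℝ E]
  [MeasurableSpace E] [BorelSpace E] {μ : Measure E} [μ.IsAddHaarMeasure]

theorem integrable_exp_neg_mul_norm {c : ℝ} (hc : 0 < c) :
    Integrable (fun x : E => Real.exp (-(c * ‖x‖))) μ := by
  let n := Module.finrank ℝ E + 1
  have h : Integrable (fun x : E => (1 + ‖x‖) ^ (-(n : ℝ))) μ :=
    integrable_one_add_norm (by simp [n])
  refine (h.const_mul (n.factorial * Real.exp c / c ^ n)).mono'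
    (by fun_prop) (Eventually.of_forall fun x => ?_)
  rw [Real.norm_of_nonneg (Real.exp_pos _).le, Real.rpow_neg (by positivity), Real.rpow_natCast]
  exact exp_neg_mul_le_mul_one_add_pow hc (norm_nonneg x) n

/-- The function `s ↦ ∫_C exp (-(conj ζ + s ζ))` attached to a complex coordinate `ζ`. -/
noncomputable def coneLaplace (μ : Measure E) (C : Set E) (ζ : E →L[ℝ] ℂ) (s : ℂ) : ℂ :=
  ∫ x in C, Complex.exp (-((starRingEnd ℂ) (ζ x) + s * ζ x)) ∂μ

/-- For real `θ ∈ [0, 1]` near `s`, the term `θ z` only helps, and the remaining `(s - θ) z` costs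
at most half of `Re z̄ ≥ c n`. -/
theorem le_re_conj_add_mul {c δ M n : ℝ} {s z : ℂ} (hδ : δ * M ≤ c / 2) (hn : 0 ≤ n)
    (hc : 0 ≤ c)
    (hs : s ∈ Metric.thickening δ (segment ℝ (0 : ℂ) 1)) (hz : c * n ≤ z.re)
    (hz' : ‖z‖ ≤ M * n) :
    c / 2 * n ≤ ((starRingEnd ℂ) z + s * z).re := by
  obtain ⟨τ, hτ, hsτ⟩ := Metric.mem_thickening_iff.1 hs
  rw [segment_eq_image] at hτ
  obtain ⟨θ, hθ, rfl⟩ := hτ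
  have hθ' : (1 - θ) • (0 : ℂ) + θ • (1 : ℂ) = (θ : ℂ) := by simp
  simp only [hθ', Complex.dist_eq] at hsτ
  have e : (starRingEnd ℂ) z + s * z = (starRingEnd ℂ) z + (θ : ℂ) * z + (s - θ) * z := by ring
  have h1 : -(δ * (M * n)) ≤ ((s - θ) * z).re := by
    have h2 := (abs_le.1 (Complex.abs_re_le_norm ((s - θ) * z))).1
    rw [norm_mul] at h2
    have h3 : ‖s - θ‖ * ‖z‖ ≤ δ * (M * n) :=
      mul_le_mul hsτ.le hz' (norm_nonneg _) ((norm_nonneg _).trans hsτ.le)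
    linarith
  have h0 : 0 ≤ z.re := (by positivity : 0 ≤ c * n).trans hz
  have h4 : δ * (M * n) ≤ c / 2 * n := by rw [← mul_assoc]; gcongr
  have h5 : 0 ≤ θ * z.re := mul_nonneg hθ.1 h0
  rw [e, Complex.add_re, Complex.add_re, Complex.conj_re, Complex.re_ofReal_mul]
  linarith

theorem norm_exp_neg_le {z : ℂ} {b : ℝ} (h : b ≤ z.re) :
    ‖Complex.exp (-z)‖ ≤ Real.exp (-b) := by
  rw [Complex.norm_exp]
  simpa using h

theorem differentiableOn_coneLaplace {C : Set E} (hC : MeasurableSet C) {ζ : E →L[ℝ] ℂ} {c δ : ℝ}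
    (hc : 0 < c) (hδ : δ * ‖ζ‖ ≤ c / 2) (hζ : ∀ x ∈ C, c * ‖x‖ ≤ (ζ x).re) :
    DifferentiableOn ℂ (coneLaplace μ C ζ) (Metric.thickening δ (segment ℝ (0 : ℂ) 1)) := by
  intro s₀ hs₀
  have hre : ∀ s ∈ Metric.thickening δ (segment ℝ (0 : ℂ) 1), ∀ x ∈ C,
      c / 2 * ‖x‖ ≤ ((starRingEnd ℂ) (ζ x) + s * ζ x).re := fun s hs x hx =>
    le_re_conj_add_mul hδ (norm_nonneg x) hc.le hs (hζ x hx) (ζ.le_opNorm x)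
  have hcont : ∀ s : ℂ, Continuous fun x : E =>
      Complex.exp (-((starRingEnd ℂ) (ζ x) + s * ζ x)) := fun s => by
    have := Complex.continuous_conj
    fun_prop
  have hmem : ∀ᵐ x ∂μ.restrict C, x ∈ C := ae_restrict_mem hC
  refine (hasDerivAt_integral_of_dominated_loc_of_deriv_le (𝕜 := ℂ)
    -- Half of the decay rate `c / 2` absorbs the factor `ζ x` produced by differentiation.
    (bound := fun x => ‖ζ‖ * (4 / c) * Real.exp (-(c / 4 * ‖x‖)))
    (F' := fun s x => Complex.exp (-((starRingEnd ℂ) (ζ x) + s * ζ x)) * -(ζ x))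
    (Metric.isOpen_thickening.mem_nhds hs₀)
    (Eventually.of_forall fun s => (hcont s).aestronglyMeasurable) ?_
    ((hcont s₀).mul ζ.continuous.neg).aestronglyMeasurable ?_ ?_
    ?_).2.differentiableAt.differentiableWithinAt
  · refine (integrable_exp_neg_mul_norm (by positivity : 0 < c / 2)).integrableOn.mono'
      (hcont s₀).aestronglyMeasurable ?_
    filter_upwards [hmem] with x hx
    exact norm_exp_neg_le (hre s₀ hs₀ x hx)
  · filter_upwards [hmem] with x hx s hs
    rw [norm_mul, norm_neg]
    have h1 := norm_exp_neg_le (hre s hs x hx)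
    have h2 : c / 4 * ‖x‖ ≤ Real.exp (c / 4 * ‖x‖) := by
      linarith [Real.add_one_le_exp (c / 4 * ‖x‖)]
    have h3 : Real.exp (-(c / 2 * ‖x‖)) * Real.exp (c / 4 * ‖x‖)
        = Real.exp (-(c / 4 * ‖x‖)) := by
      rw [← Real.exp_add]; congr 1; ring
    calc _ ≤ Real.exp (-(c / 2 * ‖x‖)) * (‖ζ‖ * ‖x‖) :=
          mul_le_mul h1 (ζ.le_opNorm x) (norm_nonneg _) (Real.exp_pos _).le
      _ = ‖ζ‖ * (4 / c) * (Real.exp (-(c / 2 * ‖x‖)) * (c / 4 * ‖x‖)) := by field_simp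
      _ ≤ ‖ζ‖ * (4 / c) * (Real.exp (-(c / 2 * ‖x‖)) * Real.exp (c / 4 * ‖x‖)) := by gcongr
      _ = _ := by rw [h3]
  · exact ((integrable_exp_neg_mul_norm (by positivity : 0 < c / 4)).const_mul _).integrableOn
  · refine Eventually.of_forall fun x s _ => ?_
    have h : HasDerivAt (fun s : ℂ => -((starRingEnd ℂ) (ζ x) + s * ζ x)) (-(ζ x)) s := by
      simpa only [id_eq, one_mul] using
        (((hasDerivAt_id s).mul_const (ζ x)).const_add ((starRingEnd ℂ) (ζ x))).fun_neg
    exact h.cexp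

theorem coneLaplace_one_ne_zero {C : Set E} (hC : MeasurableSet C) (hμC : μ C ≠ 0)
    {ζ : E →L[ℝ] ℂ} {c : ℝ} (hc : 0 < c) (hζ : ∀ x ∈ C, c * ‖x‖ ≤ (ζ x).re) :
    coneLaplace μ C ζ 1 ≠ 0 := by
  have e : coneLaplace μ C ζ 1 = ((∫ x in C, Real.exp (-(2 * (ζ x).re)) ∂μ : ℝ) : ℂ) := by
    rw [coneLaplace, ← integral_complex_ofReal]
    congr 1 with x
    rw [one_mul, add_comm, Complex.add_conj]
    push_cast
    rfl
  have : NeZero (μ.restrict C) := ⟨by rwa [Ne, Measure.restrict_eq_zero]⟩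
  rw [e, Complex.ofReal_ne_zero]
  refine (integral_exp_pos (μ := μ.restrict C) (f := fun x => -(2 * (ζ x).re)) ?_).ne'
  refine (integrable_exp_neg_mul_norm hc).integrableOn.mono'
    (by fun_prop) ?_
  filter_upwards [ae_restrict_mem hC] with x hx
  rw [Real.norm_of_nonneg (Real.exp_pos _).le, Real.exp_le_exp]
  have := hζ x hx
  have : 0 ≤ c * ‖x‖ := by positivity
  linarith

theorem tendsto_div_ofReal_sq_atTop (κ : ℂ) :
    Tendsto (fun r : ℝ => κ / (r : ℂ) ^ 2) atTop (𝓝 0) := by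
  rw [tendsto_zero_iff_norm_tendsto_zero]
  simp only [norm_div, norm_pow, Complex.norm_real, Real.norm_eq_abs, sq_abs]
  exact tendsto_const_nhds.div_atTop (tendsto_pow_atTop two_ne_zero)

/-- Otherwise `g s = s ^ m * f s` with `f 0 ≠ 0`; dividing by `s ^ m` costs only the power `r ^ (2 *
m)`, which the exponential beats. -/
theorem AnalyticAt.eventually_eq_zero_of_exp_decay {g : ℂ → ℂ} (hg : AnalyticAt ℂ g 0) {κ : ℂ}
    (hκ : κ ≠ 0) {K δ : ℝ} (hδ : 0 < δ) (n : ℕ)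
    (h : ∀ᶠ r : ℝ in atTop, ‖g (κ / (r : ℂ) ^ 2)‖ ≤ K * (r ^ n * Real.exp (-(δ * r)))) :
    ∀ᶠ s in 𝓝 (0 : ℂ), g s = 0 := by
  by_contra hne
  obtain ⟨m, f, hf, hf0, hgf⟩ := hg.exists_eventuallyEq_pow_smul_nonzero_iff.2 hne
  have hlim := tendsto_div_ofReal_sq_atTop κ
  have hflim : Tendsto (fun r : ℝ => ‖f (κ / (r : ℂ) ^ 2)‖) atTop (𝓝 ‖f 0‖) :=
    (hf.continuousAt.tendsto.comp hlim).norm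
  have hdecay : Tendsto (fun r : ℝ => K / ‖κ‖ ^ m * (r ^ (n + 2 * m) * Real.exp (-(δ * r)))) atTop
      (𝓝 0) := by
    have := (tendsto_rpow_mul_exp_neg_mul_atTop_nhds_zero ((n + 2 * m : ℕ) : ℝ) δ hδ).const_mul
      (K / ‖κ‖ ^ m)
    simpa only [Real.rpow_natCast, mul_zero, neg_mul] using this
  refine hf0 (norm_le_zero_iff.1 (le_of_tendsto_of_tendsto hflim hdecay ?_))
  filter_upwards [h, hlim.eventually hgf, eventually_gt_atTop 0] with r h1 h2 hr
  rw [h2, smul_eq_mul, sub_zero, norm_mul, norm_pow, norm_div, norm_pow, Complex.norm_real,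
    Real.norm_of_nonneg hr.le] at h1
  have hκ' : 0 < ‖κ‖ := norm_pos_iff.2 hκ
  have e : ‖f (κ / (r : ℂ) ^ 2)‖ = (r ^ (2 * m) / ‖κ‖ ^ m) *
      ((‖κ‖ / r ^ 2) ^ m * ‖f (κ / (r : ℂ) ^ 2)‖) := by
    rw [div_pow, ← pow_mul]; field_simp
  calc _ = _ := e
    _ ≤ (r ^ (2 * m) / ‖κ‖ ^ m) * (K * (r ^ n * Real.exp (-(δ * r)))) := by gcongr
    _ = _ := by rw [pow_add]; ring

end LaplaceTransform

/-! ### The tangent cone of a polytope at a vertex. -/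

section TangentCone

open MeasureTheory Filter Topology

/-- The cone `ℝ_{>0} • P`. -/
def positiveHull {E : Type*} [AddCommGroup E] [Module ℝ E] (P : Set E) : Set E :=
  {x | ∃ r : ℝ, 0 < r ∧ r • x ∈ P}

theorem subset_positiveHull {E : Type*} [AddCommGroup E] [Module ℝ E] (P : Set E) :
    P ⊆ positiveHull P := fun x hx => ⟨1, one_pos, by rwa [one_smul]⟩

open scoped Pointwise in
theorem smul_positiveHull {E : Type*} [AddCommGroup E] [Module ℝ E] (P : Set E) {r : ℝ}
    (hr : 0 < r) : r • positiveHull P = positiveHull P := by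
  ext x
  rw [Set.mem_smul_set_iff_inv_smul_mem₀ hr.ne']
  constructor
  · rintro ⟨t, ht, h⟩
    exact ⟨t * r⁻¹, by positivity, by rwa [mul_smul]⟩
  · rintro ⟨t, ht, h⟩
    refine ⟨t * r, by positivity, ?_⟩
    rwa [smul_smul, mul_assoc, mul_inv_cancel₀ hr.ne', mul_one]

theorem measurableSet_positiveHull {E : Type*} [NormedAddCommGroup E] [NormedSpace ℝ E]
    [MeasurableSpace E] [BorelSpace E] {P : Set E} (hP : IsClosed P) (hconv : Convex ℝ P)
    (h0 : (0 : E) ∈ P) : MeasurableSet (positiveHull P) := by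
  have e : positiveHull P = ⋃ n : ℕ, (fun x : E => (1 / ((n : ℝ) + 1)) • x) ⁻¹' P := by
    ext x
    simp only [Set.mem_iUnion, Set.mem_preimage]
    constructor
    · rintro ⟨r, hr, hx⟩
      obtain ⟨n, hn⟩ := exists_nat_one_div_lt hr
      refine ⟨n, ?_⟩
      have := hconv.smul_mem_of_zero_mem h0 hx (t := 1 / ((n : ℝ) + 1) / r)
        ⟨by positivity, (div_le_one hr).2 hn.le⟩
      rwa [smul_smul, div_mul_cancel₀ _ hr.ne'] at this
    · rintro ⟨n, hn⟩
      exact ⟨_, by positivity, hn⟩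
  rw [e]
  exact MeasurableSet.iUnion fun n => (hP.preimage (continuous_const_smul _)).measurableSet

theorem exists_mul_norm_le_of_mem_positiveHull {E : Type*} [NormedAddCommGroup E]
    [NormedSpace ℝ E] {S : Set E} (hS : S.Finite) {L : E →L[ℝ] ℝ}
    (hL : ∀ s ∈ S, s ≠ 0 → 0 < L s) :
    ∃ c > 0, ∀ x ∈ positiveHull (convexHull ℝ S), c * ‖x‖ ≤ L x := by
  have h : ∀ᶠ c : ℝ in 𝓝[>] 0, ∀ s ∈ S, c * ‖s‖ ≤ L s := by
    refine (eventually_all_finite hS).2 fun s hs => ?_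
    by_cases h0 : s = 0
    · simp [h0]
    · have h1 := hL s hs h0
      have h2 : Tendsto (fun c : ℝ => c * ‖s‖) (𝓝[>] 0) (𝓝 0) := by
        have : Tendsto (fun c : ℝ => c * ‖s‖) (𝓝 0) (𝓝 (0 * ‖s‖)) :=
          (continuous_id.mul continuous_const).tendsto 0
        rw [zero_mul] at this
        exact this.mono_left nhdsWithin_le_nhds
      exact (h2.eventually (gt_mem_nhds h1)).mono fun _ h => h.le
  obtain ⟨c, hc, hc0⟩ := (h.and self_mem_nhdsWithin).exists
  refine ⟨c, hc0, ?_⟩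
  have hull : convexHull ℝ S ⊆ {x | c * ‖x‖ ≤ L x} := by
    refine convexHull_min hc fun x hx z hz p q hp hq _ => ?_
    simp only [Set.mem_ofPred_eq, map_add, map_smul, smul_eq_mul] at hx hz ⊢
    have h1 := norm_add_le (p • x) (q • z)
    rw [norm_smul, norm_smul, Real.norm_of_nonneg hp, Real.norm_of_nonneg hq] at h1
    have h2 := mul_le_mul_of_nonneg_left hx hp
    have h3 := mul_le_mul_of_nonneg_left hz hq
    have h4 := mul_le_mul_of_nonneg_left h1 (le_of_lt hc0)
    linarith
  rintro x ⟨r, hr, hx⟩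
  have := hull hx
  simp only [Set.mem_ofPred_eq, map_smul, smul_eq_mul, norm_smul, Real.norm_of_nonneg hr.le] at this
  have h2 : r * (c * ‖x‖) ≤ r * L x := by linarith
  exact le_of_mul_le_mul_left h2 hr

/-- Write `x` as a nonnegative combination of the nonzero points of `S`. If `L ≥ m` on them and `L x
≤ m`, the coefficients sum to at most `1`, and the missing mass goes to `0`. -/
theorem exists_mem_convexHull_of_mem_positiveHull {E : Type*} [NormedAddCommGroup E]
    [NormedSpace ℝ E] {S : Set E} (hS : S.Finite) (h0 : (0 : E) ∈ S) {L : E →L[ℝ] ℝ}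
    (hL : ∀ s ∈ S, s ≠ 0 → 0 < L s) :
    ∃ ε > 0, ∀ x ∈ positiveHull (convexHull ℝ S), ‖x‖ < ε → x ∈ convexHull ℝ S := by
  classical
  have h : ∀ᶠ m : ℝ in 𝓝[>] 0, ∀ s ∈ S, s ≠ 0 → m ≤ L s := by
    refine (eventually_all_finite hS).2 fun s hs => ?_
    by_cases hs0 : s = 0
    · simp [hs0]
    · have : Set.Iic (L s) ∈ 𝓝[>] (0 : ℝ) := mem_nhdsWithin_of_mem_nhds (Iic_mem_nhds (hL s hs hs0))
      filter_upwards [this] with m hm _ using hm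
  obtain ⟨m, hm, hm0⟩ := (h.and self_mem_nhdsWithin).exists
  replace hm0 : 0 < m := hm0
  refine ⟨m / (‖L‖ + 1), by positivity, ?_⟩
  rintro x ⟨r, hr, hx⟩ hxε
  have hLx : L x ≤ m := by
    rw [lt_div_iff₀ (by positivity)] at hxε
    have h1 := (le_abs_self _).trans (L.le_opNorm x)
    nlinarith [norm_nonneg x]
  have hT : (↑(insert 0 (hS.toFinset.erase 0)) : Set E) = S := by
    rw [Finset.insert_erase (hS.mem_toFinset.2 h0), hS.coe_toFinset]
  set T := hS.toFinset.erase 0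
  have hTS : ∀ y ∈ T, y ∈ S ∧ y ≠ 0 := fun y hy =>
    ⟨hS.mem_toFinset.1 (Finset.mem_of_mem_erase hy), Finset.ne_of_mem_erase hy⟩
  have h0T : (0 : E) ∉ T := Finset.notMem_erase _ _
  rw [← hT, Finset.mem_convexHull'] at hx
  obtain ⟨w, hw, -, hwx⟩ := hx
  rw [Finset.sum_insert h0T, smul_zero, zero_add] at hwx
  have hx' : ∑ y ∈ T, (r⁻¹ * w y) • y = x := by
    simp only [mul_smul, ← Finset.smul_sum]
    rw [hwx, smul_smul, inv_mul_cancel₀ hr.ne', one_smul]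
  have hw' : ∀ y ∈ T, 0 ≤ r⁻¹ * w y := fun y hy =>
    mul_nonneg (inv_nonneg.2 hr.le) (hw y (Finset.mem_insert_of_mem hy))
  have hsum : ∑ y ∈ T, r⁻¹ * w y ≤ 1 := by
    have h1 : (∑ y ∈ T, r⁻¹ * w y) * m ≤ L x := by
      rw [← hx', map_sum, Finset.sum_mul]
      refine Finset.sum_le_sum fun y hy => ?_
      rw [map_smul, smul_eq_mul]
      exact mul_le_mul_of_nonneg_left (hm y (hTS y hy).1 (hTS y hy).2) (hw' y hy)
    by_contra! hlt
    nlinarith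
  rw [← hT, Finset.mem_convexHull']
  have hne : ∀ y ∈ T, y ≠ 0 := fun y hy => (hTS y hy).2
  refine ⟨fun y => if y = 0 then 1 - ∑ y ∈ T, r⁻¹ * w y else r⁻¹ * w y, ?_, ?_, ?_⟩
  · intro y hy
    rcases Finset.mem_insert.1 hy with rfl | hy
    · simpa using hsum
    · simpa [hne y hy] using hw' y hy
  · rw [Finset.sum_insert h0T, if_pos rfl,
      Finset.sum_congr rfl fun y hy => if_neg (hne y hy)]
    ring
  · rw [Finset.sum_insert h0T, smul_zero, zero_add, ← hx']
    exact Finset.sum_congr rfl fun y hy => by simp only [if_neg (hne y hy)]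

end TangentCone

/-! ### Comparison of the polytope with its cone at a vertex. -/

section VertexAsymptotics

open MeasureTheory Filter Topology

variable {E : Type*} [NormedAddCommGroup E] [NormedSpace ℝ E] [FiniteDimensional ℝ E]
  [MeasurableSpace E] [BorelSpace E] {μ : Measure E} [μ.IsAddHaarMeasure]

theorem integral_cone_eq_pow_mul_coneLaplace (P : Set E) (ζ : E →L[ℝ] ℂ) (s : ℂ) {R : ℝ}
    (hR : 0 < R) :
    ∫ x in positiveHull P, Complex.exp (-(R * ((starRingEnd ℂ) (ζ x) + s * ζ x))) ∂μ
      = (R ^ Module.finrank ℝ E)⁻¹ • coneLaplace μ (positiveHull P) ζ s := by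
  have h := Measure.setIntegral_comp_smul_of_pos μ
    (fun x : E => Complex.exp (-((starRingEnd ℂ) (ζ x) + s * ζ x))) (positiveHull P) hR
  rw [smul_positiveHull P hR] at h
  rw [coneLaplace, ← h]
  congr 1 with x
  congr 2
  simp only [map_smul, Complex.real_smul, map_mul, Complex.conj_ofReal]
  ring

/-- Only `C \ P` contributes, and there `‖x‖ ≥ ε`. Half of the exponent `R b ‖x‖` yields the small
factor; the other half, as `R ≥ 1`, keeps the integral bounded. -/
theorem norm_coneLaplace_le {P C : Set E} (hP : MeasurableSet P) (hC : MeasurableSet C)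
    (hPC : P ⊆ C) {ζ : E →L[ℝ] ℂ} {b ε R : ℝ} {s : ℂ} (hb : 0 < b) (hR : 1 ≤ R)
    (hball : ∀ x ∈ C, ‖x‖ < ε → x ∈ P)
    (hre : ∀ x ∈ C, b * ‖x‖ ≤ ((starRingEnd ℂ) (ζ x) + s * ζ x).re)
    (hzero : ∫ x in P, Complex.exp (-(R * ((starRingEnd ℂ) (ζ x) + s * ζ x))) ∂μ = 0) :
    ‖∫ x in C, Complex.exp (-(R * ((starRingEnd ℂ) (ζ x) + s * ζ x))) ∂μ‖
      ≤ (∫ x : E, Real.exp (-(b / 2 * ‖x‖)) ∂μ) * Real.exp (-(b / 2 * ε * R)) := by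
  have hR0 : 0 < R := by linarith
  have hcont : Continuous fun x : E =>
      Complex.exp (-(R * ((starRingEnd ℂ) (ζ x) + s * ζ x))) := by
    have := Complex.continuous_conj
    fun_prop
  have hle : ∀ x ∈ C, ‖Complex.exp (-(R * ((starRingEnd ℂ) (ζ x) + s * ζ x)))‖
      ≤ Real.exp (-(R * (b * ‖x‖))) := fun x hx => by
    refine norm_exp_neg_le ?_
    rw [Complex.re_ofReal_mul]
    exact mul_le_mul_of_nonneg_left (hre x hx) hR0.le
  have hint : IntegrableOn (fun x : E =>
      Complex.exp (-(R * ((starRingEnd ℂ) (ζ x) + s * ζ x)))) C μ := by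
    refine (integrable_exp_neg_mul_norm (mul_pos hR0 hb)).integrableOn.mono'
      hcont.aestronglyMeasurable ?_
    filter_upwards [ae_restrict_mem hC] with x hx
    rw [mul_assoc]
    exact hle x hx
  have hdiff := setIntegral_sdiff hP hint hPC
  rw [hzero, sub_zero] at hdiff
  rw [← hdiff]
  have hexp := integrable_exp_neg_mul_norm (E := E) (μ := μ) (by positivity : 0 < b / 2)
  calc _ ≤ ∫ x in C \ P, Real.exp (-(b / 2 * ‖x‖)) * Real.exp (-(b / 2 * ε * R)) ∂μ := by
        refine norm_integral_le_of_norm_le (hexp.mul_const _).integrableOn ?_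
        filter_upwards [ae_restrict_mem (hC.diff hP)] with x hx
        refine (hle x hx.1).trans ?_
        rw [← Real.exp_add, Real.exp_le_exp]
        have hxε : ε ≤ ‖x‖ := not_lt.1 fun h => hx.2 (hball x hx.1 h)
        have h1 : b / 2 * R * ε ≤ b / 2 * R * ‖x‖ := by gcongr
        have h2 : b / 2 * ‖x‖ * 1 ≤ b / 2 * ‖x‖ * R := by gcongr
        linarith
    _ ≤ ∫ x : E, Real.exp (-(b / 2 * ‖x‖)) * Real.exp (-(b / 2 * ε * R)) ∂μ :=
        setIntegral_le_integral (hexp.mul_const _)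
          (Eventually.of_forall fun x => by positivity)
    _ = _ := integral_mul_const _ _

theorem exists_integral_exp_ne_zero {S : Set E} (hS : S.Finite) (h0 : (0 : E) ∈ S)
    (hμ : μ (convexHull ℝ S) ≠ 0) {ζ : E →L[ℝ] ℂ} (hζ : ∀ s ∈ S, s ≠ 0 → 0 < (ζ s).re)
    {κ : ℂ} (hκ : κ ≠ 0) :
    ∃ r : ℝ, 0 < r ∧ ∫ x in convexHull ℝ S,
      Complex.exp (-(r * (starRingEnd ℂ) (ζ x) + (r : ℂ)⁻¹ * κ * ζ x)) ∂μ ≠ 0 := by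
  by_contra! hzero
  set P := convexHull ℝ S
  have hPclosed : IsClosed P := hS.isClosed_convexHull ℝ
  have hPm : MeasurableSet P := hPclosed.measurableSet
  have h0P : (0 : E) ∈ P := subset_convexHull ℝ S h0
  have hC := measurableSet_positiveHull hPclosed (convex_convexHull ℝ S) h0P
  have hPC := subset_positiveHull P
  obtain ⟨c, hc, hcone⟩ := exists_mul_norm_le_of_mem_positiveHull hS
    (L := Complex.reCLM.comp ζ) hζ
  obtain ⟨ε, hε, hball⟩ := exists_mem_convexHull_of_mem_positiveHull hS h0
    (L := Complex.reCLM.comp ζ) hζ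
  let δ := c / (2 * (‖ζ‖ + 1))
  have hδ0 : 0 < δ := by positivity
  have hδ : δ * ‖ζ‖ ≤ c / 2 := by
    have h1 : δ * (‖ζ‖ + 1) = c / 2 := by simp only [δ]; field_simp
    nlinarith
  let D := Metric.thickening δ (segment ℝ (0 : ℂ) 1)
  have hDopen : IsOpen D := Metric.isOpen_thickening
  have hseg : segment ℝ (0 : ℂ) 1 ⊆ D := Metric.self_subset_thickening hδ0 _
  have h0D : (0 : ℂ) ∈ D := hseg (left_mem_segment ℝ _ _)
  have han : AnalyticOnNhd ℂ (coneLaplace μ (positiveHull P) ζ) D :=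
    (differentiableOn_coneLaplace hC hc hδ hcone).analyticOnNhd hDopen
  have hev : ∀ᶠ s in 𝓝 (0 : ℂ), coneLaplace μ (positiveHull P) ζ s = 0 := by
    refine (han 0 h0D).eventually_eq_zero_of_exp_decay hκ
      (K := ∫ x : E, Real.exp (-(c / 2 / 2 * ‖x‖)) ∂μ)
      (δ := c / 2 / 2 * ε) (by positivity) (Module.finrank ℝ E) ?_
    have hlim := tendsto_div_ofReal_sq_atTop κ
    filter_upwards [hlim.eventually (hDopen.mem_nhds h0D), eventually_ge_atTop 1] with r hrD hR
    have hr : 0 < r := by linarith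
    have hzero' : ∫ x in P, Complex.exp (-((r : ℂ) * ((starRingEnd ℂ) (ζ x) + κ / (r : ℂ) ^ 2 * ζ x))) ∂μ = 0 := by
      rw [← hzero r hr]
      congr 1 with x
      congr 2
      have : (r : ℂ) ≠ 0 := Complex.ofReal_ne_zero.2 hr.ne'
      field_simp
    have h1 := norm_coneLaplace_le hPm hC hPC (by positivity : 0 < c / 2) hR hball
      (fun x hx => le_re_conj_add_mul hδ (norm_nonneg x) hc.le hrD (hcone x hx) (ζ.le_opNorm x))
      hzero'
    rw [integral_cone_eq_pow_mul_coneLaplace P ζ _ hr, norm_smul, norm_inv, norm_pow,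
      Real.norm_of_nonneg hr.le, inv_mul_le_iff₀ (by positivity)] at h1
    refine h1.trans (le_of_eq ?_)
    ring
  have hD : IsPreconnected D := ((convex_segment (0 : ℂ) 1).thickening δ).isPreconnected
  -- The vanishing near `0` is carried along the segment to `s = 1`.
  have h1 := han.eqOn_zero_of_preconnected_of_eventuallyEq_zero hD h0D hev
    (hseg (right_mem_segment ℝ _ _))
  refine coneLaplace_one_ne_zero hC (fun h => hμ (measure_mono_null hPC h)) hc hcone h1

end VertexAsymptotics

/-! ### Analytic continuation of the circle and passage to the plane coordinate. -/

section ComplexCircle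

open MeasureTheory Filter Topology

theorem differentiable_integral_exp_cos_sin {E : Type*} [NormedAddCommGroup E]
    [MeasurableSpace E] [BorelSpace E] {μ : Measure E} [IsFiniteMeasureOnCompacts μ] {P : Set E}
    (hP : IsCompact P) {A B : E → ℂ} (hA : Continuous A) (hB : Continuous B) :
    Differentiable ℂ fun t : ℂ =>
      ∫ x in P, Complex.exp (Complex.cos t * A x + Complex.sin t * B x) ∂μ := by
  intro t₀
  let F : ℂ → E → ℂ := fun t x => Complex.exp (Complex.cos t * A x + Complex.sin t * B x)
  let F' : ℂ → E → ℂ := fun t x => F t x * (-Complex.sin t * A x + Complex.cos t * B x)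
  have hcos := Complex.continuous_cos
  have hsin := Complex.continuous_sin
  have hF : Continuous fun p : ℂ × E => F p.1 p.2 := by
    simp only [F]; fun_prop
  have hF' : Continuous fun p : ℂ × E => F' p.1 p.2 := by
    simp only [F']; fun_prop
  have hslice : ∀ {G : ℂ → E → ℂ}, (Continuous fun p : ℂ × E => G p.1 p.2) →
      ∀ t, IntegrableOn (G t) P μ := fun hG t =>
    (hG.comp (by fun_prop : Continuous fun x : E => (t, x))).continuousOn.integrableOn_compact hP
  obtain ⟨M, hM⟩ := ((isCompact_closedBall t₀ 1).prod hP).exists_bound_of_continuousOn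
    hF'.continuousOn
  refine (hasDerivAt_integral_of_dominated_loc_of_deriv_le (𝕜 := ℂ) (F := F) (F' := F')
    (bound := fun _ => M) (Metric.closedBall_mem_nhds t₀ one_pos)
    (Eventually.of_forall fun t => (hslice hF t).aestronglyMeasurable) (hslice hF t₀)
    (hslice hF' t₀).aestronglyMeasurable ?_ ?_ ?_).2.differentiableAt
  · filter_upwards [ae_restrict_mem hP.measurableSet] with x hx t ht
    exact hM (t, x) ⟨ht, hx⟩
  · exact integrableOn_const hP.measure_lt_top.ne
  · exact Eventually.of_forall fun x t _ =>
      (((Complex.hasDerivAt_cos t).mul_const (A x)).add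
        ((Complex.hasDerivAt_sin t).mul_const (B x))).cexp

theorem eq_zero_of_differentiable_of_forall_mem_Icc {g : ℂ → ℂ} (hg : Differentiable ℂ g)
    {a b : ℝ} (hab : a < b) (h : ∀ t ∈ Set.Icc a b, g t = 0) (t : ℂ) : g t = 0 := by
  have han : AnalyticOnNhd ℂ g Set.univ := fun z _ => hg.analyticAt z
  have hmap : Tendsto (fun t : ℝ => (t : ℂ)) (𝓝[>] a) (𝓝[≠] (a : ℂ)) :=
    tendsto_nhdsWithin_iff.2 ⟨(Complex.continuous_ofReal.tendsto a).mono_left nhdsWithin_le_nhds, by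
      filter_upwards [self_mem_nhdsWithin] with s hs
      exact fun h => (ne_of_gt hs) (Complex.ofReal_injective h)⟩
  refine han.eqOn_zero_of_preconnected_of_frequently_eq_zero isPreconnected_univ
    (Set.mem_univ (a : ℂ)) (hmap.frequently (Eventually.frequently ?_)) (Set.mem_univ t)
  filter_upwards [Ioc_mem_nhdsGT hab] with s hs
  exact h s ⟨hs.1.le, hs.2⟩

theorem integral_exp_neg_eq_mul_integral_translate {E : Type*} [NormedAddCommGroup E]
    [MeasurableSpace E] [BorelSpace E] {μ : Measure E} [μ.IsAddRightInvariant]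
    (P : Set E) (φ : E → ℂ) (hφ : ∀ x z, φ (x + z) = φ x + φ z) (v : E) :
    ∫ x in P, Complex.exp (-φ x) ∂μ
      = Complex.exp (-φ v) * ∫ x in (fun x => x + v) ⁻¹' P, Complex.exp (-φ x) ∂μ := by
  rw [← (measurePreserving_add_right μ v).setIntegral_preimage_emb
    (MeasurableEquiv.addRight v).measurableEmbedding, ← integral_const_mul]
  congr 1 with x
  rw [hφ, ← Complex.exp_add]
  congr 1
  ring

theorem volume_convexHull_ne_zero {d : ℕ} {P : Set (EuclideanSpace ℝ (Fin d))}
    (hP : Convex ℝ P) (hne : P.Nonempty) (hdim : Module.finrank ℝ (vectorSpan ℝ P) = d) :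
    volume P ≠ 0 := by
  have htop : vectorSpan ℝ P = ⊤ := Submodule.eq_top_of_finrank_eq (by rw [hdim]; simp)
  have haff : affineSpan ℝ P = ⊤ :=
    (AffineSubspace.affineSpan_eq_top_iff_vectorSpan_eq_top_of_nonempty _ _ _ hne).2 htop
  have hint := hP.interior_nonempty_iff_affineSpan_eq_top.2 haff
  exact (Measure.measure_pos_of_nonempty_interior volume hint).ne'

/-- The parameter `t = -i log W` satisfies `exp (i t) = W`, so complex `t` reach every nonzero `W`.
-/
theorem cos_mul_add_sin_mul_log {W u v : ℂ} (hW : W ≠ 0) :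
    Complex.cos (-Complex.I * Complex.log W) * u + Complex.sin (-Complex.I * Complex.log W) * v
      = (W * (u - Complex.I * v) + W⁻¹ * (u + Complex.I * v)) / 2 := by
  have e1 : -Complex.I * Complex.log W * Complex.I = Complex.log W := by
    linear_combination -Complex.log W * Complex.I_mul_I
  have e2 : -(-Complex.I * Complex.log W) * Complex.I = -Complex.log W := by
    linear_combination Complex.log W * Complex.I_mul_I
  rw [Complex.cos, Complex.sin, e1, e2, Complex.exp_neg, Complex.exp_log hW]
  ring

/-- The complex coordinate of the projection to the plane spanned by `e` and `f`. -/
noncomputable def planeCoord {d : ℕ} (e f : EuclideanSpace ℝ (Fin d)) :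
    EuclideanSpace ℝ (Fin d) →L[ℝ] ℂ :=
  Complex.ofRealCLM.comp (innerSL ℝ e) + Complex.I • Complex.ofRealCLM.comp (innerSL ℝ f)

theorem planeCoord_apply {d : ℕ} (e f x : EuclideanSpace ℝ (Fin d)) :
    planeCoord e f x = (⟪e, x⟫_ℝ : ℂ) + Complex.I * (⟪f, x⟫_ℝ : ℂ) := by
  simp [planeCoord]

theorem conj_planeCoord {d : ℕ} (e f x : EuclideanSpace ℝ (Fin d)) :
    (starRingEnd ℂ) (planeCoord e f x) = (⟪e, x⟫_ℝ : ℂ) - Complex.I * (⟪f, x⟫_ℝ : ℂ) := by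
  rw [planeCoord_apply, map_add, map_mul, Complex.conj_ofReal, Complex.conj_ofReal,
    Complex.conj_I]
  ring

theorem fourierLaplace_circle {d : ℕ} (P : Set (EuclideanSpace ℝ (Fin d))) (α : ℂ)
    (e f : EuclideanSpace ℝ (Fin d)) (a b : ℂ) :
    fourierLaplace P (fun j => α * a * (e j : ℂ) + α * b * (f j : ℂ))
      = ∫ x in P, Complex.exp (a * (-2 * Real.pi * Complex.I * α * (⟪e, x⟫_ℝ : ℂ))
          + b * (-2 * Real.pi * Complex.I * α * (⟪f, x⟫_ℝ : ℂ))) := by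
  rw [fourierLaplace]
  congr 1 with x
  congr 1
  simp only [PiLp.inner_apply, RCLike.inner_apply, conj_trivial, Complex.ofReal_sum,
    Complex.ofReal_mul, Finset.mul_sum, ← Finset.sum_add_distrib]
  exact Finset.sum_congr rfl fun j _ => by ring

theorem integral_exp_planeCoord_eq_zero {d : ℕ} {P : Set (EuclideanSpace ℝ (Fin d))}
    (hP : IsCompact P) {α : ℂ} {e f : EuclideanSpace ℝ (Fin d)}
    (h : complexCircle α e f ⊆ nullSet P) {W : ℂ} (hW : W ≠ 0) :
    ∫ x in P, Complex.exp (-(Real.pi * Complex.I * α *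
      (W * (starRingEnd ℂ) (planeCoord e f x) + W⁻¹ * planeCoord e f x))) = 0 := by
  have hdiff := differentiable_integral_exp_cos_sin (μ := volume) hP
    (A := fun x => -2 * Real.pi * Complex.I * α * (⟪e, x⟫_ℝ : ℂ))
    (B := fun x => -2 * Real.pi * Complex.I * α * (⟪f, x⟫_ℝ : ℂ)) (by fun_prop) (by fun_prop)
  have hzero := eq_zero_of_differentiable_of_forall_mem_Icc hdiff
    (by linarith [Real.pi_pos] : -Real.pi < Real.pi) (fun t ht => by
      have h1 : fourierLaplace P _ = 0 := h ⟨t, ht, rfl⟩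
      rw [fourierLaplace_circle] at h1
      rw [← h1]
      push_cast
      rfl) (-Complex.I * Complex.log W)
  rw [← hzero]
  congr 1 with x
  rw [cos_mul_add_sin_mul_log hW, planeCoord_apply, ← planeCoord_apply, conj_planeCoord,
    planeCoord_apply]
  congr 1
  ring

end ComplexCircle

/-! ### Assembly of the contradiction. -/

open MeasureTheory in
theorem theorem2 {d : ℕ} (P : Set (EuclideanSpace ℝ (Fin d))) (hP : IsPolytope P)
    (hdim : Module.finrank ℝ (vectorSpan ℝ P) = d)
    (H : Submodule ℝ (EuclideanSpace ℝ (Fin d))) (hH : Module.finrank ℝ H = 2)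
    (hedge : ∀ F : Set (EuclideanSpace ℝ (Fin d)), IsPolytopeEdge P F →
      ¬ Submodule.IsOrtho H (vectorSpan ℝ F))
    (e f : EuclideanSpace ℝ (Fin d)) (hef : Orthonormal ℝ ![e, f])
    (hspan : Submodule.span ℝ {e, f} = H)
    (α : ℂ) (hα : α ≠ 0) :
    ¬ complexCircle α e f ⊆ nullSet P := by
  intro hcircle
  obtain ⟨S, hS, rfl⟩ := hP
  have hd : 2 ≤ d := by
    have := Submodule.finrank_le H
    rwa [hH, finrank_euclideanSpace_fin] at this
  have hne : S.Nonempty := by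
    rw [Set.nonempty_iff_ne_empty]
    rintro rfl
    rw [convexHull_empty, vectorSpan_empty, finrank_bot] at hdim
    omega
  have hHbot : H ≠ ⊥ := by
    rintro rfl
    rw [finrank_bot] at hH
    omega
  obtain ⟨v, hv, y, hyH, hy0, hy⟩ := exists_unique_minimizer_of_not_isOrtho_edge hS hne hHbot hedge
  rw [← hspan, Submodule.mem_span_pair] at hyH
  obtain ⟨p, q, rfl⟩ := hyH
  let η : ℂ := p + Complex.I * q
  have hη' : (starRingEnd ℂ) η = p - Complex.I * q := by
    simp only [η, map_add, map_mul, Complex.conj_ofReal, Complex.conj_I]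
    ring
  have hη : η ≠ 0 := by
    intro h
    have h1 := congrArg Complex.re h
    have h2 := congrArg Complex.im h
    simp [η] at h1 h2
    simp [h1, h2] at hy0
  have hηc : (starRingEnd ℂ) η ≠ 0 := (map_ne_zero _).2 hη
  -- Multiplying by `η̄` rotates the minimised direction `p • e + q • f` onto the real axis.
  let ζ : EuclideanSpace ℝ (Fin d) →L[ℝ] ℂ := (starRingEnd ℂ) η • planeCoord e f
  have hζ : ∀ x, ζ x = (starRingEnd ℂ) η * planeCoord e f x := fun x => rfl
  have hζre : ∀ x, (ζ x).re = ⟪x, p • e + q • f⟫_ℝ := fun x => by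
    rw [hζ, hη', planeCoord_apply, inner_add_right, inner_smul_right, inner_smul_right,
      real_inner_comm e, real_inner_comm f]
    simp
  let S₀ : Set (EuclideanSpace ℝ (Fin d)) := (AffineEquiv.constVAdd ℝ _ (-v)) '' S
  have hhull : convexHull ℝ S₀ = (fun x => x + v) ⁻¹' convexHull ℝ S := by
    have := AffineMap.image_convexHull
      (AffineEquiv.constVAdd ℝ (EuclideanSpace ℝ (Fin d)) (-v)).toAffineMap S
    refine (this.symm.trans ?_)
    ext x
    simp only [AffineEquiv.coe_toAffineMap, AffineEquiv.constVAdd_apply, vadd_eq_add,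
      Set.mem_image, Set.mem_preimage]
    constructor
    · rintro ⟨z, hz, rfl⟩
      simpa using hz
    · exact fun hx => ⟨x + v, hx, by abel⟩
  have hvol : volume (convexHull ℝ S₀) ≠ 0 := by
    rw [hhull, measure_preimage_add_right]
    exact volume_convexHull_ne_zero (convex_convexHull ℝ S) (hne.mono (subset_convexHull ℝ S)) hdim
  let c : ℂ := Real.pi * Complex.I * α
  have hc : c ≠ 0 := by simp [c, hα, Real.pi_ne_zero]
  obtain ⟨r, hr, hne⟩ := exists_integral_exp_ne_zero (hS.image _)
    (⟨v, hv, by simp⟩ : (0 : EuclideanSpace ℝ (Fin d)) ∈ S₀) hvol (ζ := ζ) (by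
      rintro _ ⟨s, hs, rfl⟩ hs0
      rw [hζre]
      have hsub : (AffineEquiv.constVAdd ℝ _ (-v)) s = s - v := by
        simp only [AffineEquiv.constVAdd_apply, vadd_eq_add]; abel
      rw [hsub] at hs0 ⊢
      exact hy s hs (sub_ne_zero.1 hs0))
    (κ := c ^ 2 / (η * (starRingEnd ℂ) η)) (by positivity)
  have hr' : (r : ℂ) ≠ 0 := Complex.ofReal_ne_zero.2 hr.ne'
  rw [hhull] at hne
  have hzero := integral_exp_planeCoord_eq_zero (hS.isCompact_convexHull ℝ) hcircle
    -- With this `W`, `c W z̄ = r ζ̄` and `c W⁻¹ z = r⁻¹ κ ζ` for `κ = c² / (η η̄)`.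
    (W := r * η / c) (by positivity)
  rw [integral_exp_neg_eq_mul_integral_translate _ _ (fun x z => by simp only [map_add]; ring) v]
    at hzero
  rcases mul_eq_zero.1 hzero with h | h
  · exact Complex.exp_ne_zero _ h
  · refine hne ?_
    rw [← h]
    congr 1 with x
    congr 2
    change _ = c * _
    rw [hζ, map_mul, Complex.conj_conj]
    field_simp
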